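/- Let $\mathbb T=\mathbb R/2\pi\mathbb Z$, let $\omega\in\mathbb R$, and let $\mathbf A$ be a directed graph without self-loops on the vertices $\{1,\dots,N\}$, with adjacency matrix $A_{jk}=1$ if there is an edge from $j$ to $k$ and $A_{jk}=0$ otherwise. For $g:\mathbb T\to\mathbb R$ let $DZ(g)$ (respectively $LC(g)$) be the set of points that have an open neighbourhood on which $g$ is identically zero (respectively, on which $g$ is constant). A coupling function is a non-constant $C^\infty$ function $g:\mathbb T\to\mathbb R$ with simple dead zones, that is, $DZ(g)$ has finitely many connected components and $LC(g)=DZ(g)$. Consider the network $$\dot\theta_k=\omega+\sum_{j=1}^N A_{jk}\,g(\theta_j-\theta_k),\qquad k=1,\dots,N,\qquad(1)$$ on $\mathbb T^N$. For $\theta\in\mathbb T^N$ the effective coupling graph $\mathcal G_{g,\mathbf A}(\theta)$ is the graph on $\{1,\dots,N\}$ with an edge from $j$ to $k$ if and only if $A_{jk}\ne0$ and $\theta_j-\theta_k\notin DZ(g)$. A spanning diverging tree of a directed graph is a subgraph on all the vertices whose underlying undirected graph is connected, in which one node (the root) has no incoming edge and every other node has exactly one incoming edge. A nonempty set $S\subset\mathbb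 T^N$ is asymptotically stable for (1) if it is Lyapunov stable (solutions that start close enough to $S$ stay as close to $S$ as desired for all $t\ge0$) and attracting (the distance to $S$ tends to $0$ as $t\to\infty$ along every solution that starts in some $\delta$-neighbourhood of $S$). Let $\mathbf H$ be a subgraph of $\mathbf A$ on the same vertices $\{1,\dots,N\}$ that admits a spanning diverging tree. Then there is a coupling function $g$ such that (1) has an asymptotically stable relative equilibrium with effective coupling graph $\mathbf H$: there are $\Omega\in\mathbb R$ and $\theta^o\in\mathbb T^N$ such that $t\mapsto(\Omega t+\theta^o_1,\dots,\Omega t+\theta^o_N)$ is a solution of (1), the group orbit $\{(\theta^o_1+c,\dots,\theta^o_N+c):c\in\mathbb T\}$ is asymptotically stable, and $\mathcal G_{g,\mathbf A}(\theta^o)=\mathbf H$. Moreover, the same $g$ stably realises $\mathbf H$: there is a nonempty open set $B\subset\{\theta\in\mathbb T^N:\mathcal G_{g,\mathbf A}(\theta)=\mathbf H\}$ that is invariant in forward time and asymptotically stable for (1). -/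

import Mathlib

namespace DeadZones

open Set Filter Topology Real

/-- The circle `ℝ / 2πℤ`. -/
abbrev Torus1 : Type := AddCircle (2 * π)

/-- The phase space of `N` oscillators, with the maximum metric. -/
abbrev Phases (N : ℕ) : Type := Fin N → Torus1

/-! ### Coupling functions -/

/-- The points at which `g` is locally constant. -/
def LC (g : Torus1 → ℝ) : Set Torus1 :=
  {x | ∃ c : ℝ, ∃ U : Set Torus1, IsOpen U ∧ x ∈ U ∧ ∀ y ∈ U, g y = c}

/-- The points at which `g` is locally null. -/
def DZ (g : Torus1 → ℝ) : Set Torus1 :=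
  {x | ∃ U : Set Torus1, IsOpen U ∧ x ∈ U ∧ ∀ y ∈ U, g y = 0}

open scoped ContDiff in
/-- Coupling functions: smooth, non-constant, with simple dead zones. -/
structure IsCouplingFunction (g : Torus1 → ℝ) : Prop where
  smooth : ContDiff ℝ ∞ (fun x : ℝ => g (x : Torus1))
  nonconstant : ¬ ∃ c : ℝ, ∀ x, g x = c
  finite_deadZones : Finite (ConnectedComponents (DZ g))
  locallyConstant_eq : LC g = DZ g

/-! ### Graphs -/

/-- A digraph on a vertex set is a diverging tree spanning that set: its underlying undirected graph
is connected, one node (the root) has no incoming edge, every other node has exactly one. -/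
def IsDivergingTree {V : Type*} (T : Digraph V) : Prop :=
  T.toSimpleGraphInclusive.Connected ∧
    ∃ r : V, (∀ j, ¬ T.Adj j r) ∧ ∀ k, k ≠ r → ∃! j, T.Adj j k

/-- `H` has a spanning diverging tree as a subgraph. -/
def HasSpanningDivergingTree {V : Type*} (H : Digraph V) : Prop :=
  ∃ T : Digraph V, T ≤ H ∧ IsDivergingTree T

open Classical in
/-- The adjacency matrix: the entry at `(j, k)` is `1` if there is an edge from `j` to `k`. -/
noncomputable def adjMatrix {V : Type*} (A : Digraph V) : Matrix V V ℝ :=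
  Matrix.of fun j k => if A.Adj j k then 1 else 0

/-- The effective coupling graph of the network with coupling function `g` and structural
coupling graph `A` at the state `θ`. -/
def effectiveGraph {N : ℕ} (g : Torus1 → ℝ) (A : Digraph (Fin N)) (θ : Phases N) :
    Digraph (Fin N) where
  Adj j k := A.Adj j k ∧ θ j - θ k ∉ DZ g

/-! ### Dynamics -/

/-- The right-hand side `ω + ∑ j, A j k * g (θ j - θ k)` of the phase oscillator network. -/
noncomputable def vectorField {N : ℕ} (ω : ℝ) (g : Torus1 → ℝ) (A : Digraph (Fin N))
    (θ : Phases N) (k : Fin N) : ℝ :=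
  ω + ∑ j, adjMatrix A j k * g (θ j - θ k)

/-- `θ` is a solution of the network on the time set `I` (an interval): it has a real lift `φ`,
differentiable along `I`, whose derivative is the right-hand side of the network along `θ`. -/
def IsSolutionOn {N : ℕ} (ω : ℝ) (g : Torus1 → ℝ) (A : Digraph (Fin N)) (I : Set ℝ)
    (θ : ℝ → Phases N) : Prop :=
  ∃ φ : ℝ → Fin N → ℝ, ∀ t ∈ I, ∀ k,
    ((φ t k : ℝ) : Torus1) = θ t k ∧
      HasDerivWithinAt (fun s => φ s k) (vectorField ω g A (θ t) k) I t

/-- Every solution that starts in `S` stays in `S` in forward time. -/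
def IsForwardInvariant {N : ℕ} (ω : ℝ) (g : Torus1 → ℝ) (A : Digraph (Fin N))
    (S : Set (Phases N)) : Prop :=
  ∀ θ : ℝ → Phases N, IsSolutionOn ω g A (Ici 0) θ → θ 0 ∈ S → ∀ t, 0 ≤ t → θ t ∈ S

/-- Asymptotic stability of a (nonempty) set `S`: Lyapunov stability and local attractivity. -/
def IsAsymptoticallyStable {N : ℕ} (ω : ℝ) (g : Torus1 → ℝ) (A : Digraph (Fin N))
    (S : Set (Phases N)) : Prop :=
  (∀ ε > 0, ∃ δ > 0, ∀ θ : ℝ → Phases N, IsSolutionOn ω g A (Ici 0) θ →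
    Metric.infDist (θ 0) S < δ → ∀ t, 0 ≤ t → Metric.infDist (θ t) S < ε) ∧
  ∃ δ > 0, ∀ θ : ℝ → Phases N, IsSolutionOn ω g A (Ici 0) θ →
    Metric.infDist (θ 0) S < δ → Tendsto (fun t => Metric.infDist (θ t) S) atTop (𝓝 0)

/-- The motion `t ↦ (Ω t + θ₁, …, Ω t + θ_N)` is a solution, i.e. `θ` is a relative equilibrium
with respect to the phase-shift symmetry, with frequency `Ω`. -/
def IsRelativeEquilibrium {N : ℕ} (ω : ℝ) (g : Torus1 → ℝ) (A : Digraph (Fin N))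
    (Ω : ℝ) (θ : Phases N) : Prop :=
  IsSolutionOn ω g A univ (fun t k => ((Ω * t : ℝ) : Torus1) + θ k)

/-- The orbit of `θ` under simultaneous phase shifts of all the oscillators. -/
def phaseShiftOrbit {N : ℕ} (θ : Phases N) : Set (Phases N) :=
  range fun c : Torus1 => fun k => c + θ k

/-- `g` stably realises `H` in the network with structural coupling graph `A`: some nonempty open
set of states with effective coupling graph `H` is forward invariant and asymptotically stable. -/
def StablyRealises {N : ℕ} (ω : ℝ) (g : Torus1 → ℝ) (A H : Digraph (Fin N)) : Prop :=
  ∃ B : Set (Phases N), B.Nonempty ∧ IsOpen B ∧ B ⊆ {θ | effectiveGraph g A θ = H} ∧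
    IsForwardInvariant ω g A B ∧ IsAsymptoticallyStable ω g A B

end DeadZones

namespace DeadZones

open Set Filter Topology Real

/-! Put the oscillators at phases proportional to powers of 3, so that differences along distinct
edges are distinct and uniformly separated. The values of g near these differences can then be
prescribed independently: an odd pulse centred at the difference of each edge of H, and zero near
the differences of the other edges of A. Pulses vanish at their centres, so the chosen phases rotate
rigidly with frequency ω; and the effective graph stays H under small perturbations
(`adjMatrix_mul_treeCoupling`, `effectiveGraph_treeCoupling`).

For stability, pulses on a spanning tree T of H get weight 1 and all others a small weight η > 0.
Relative to the root, the deviations then follow a small perturbation of consensus dynamics in which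
each node is pulled towards its parent. The energy ∑ μ^depth(k) x_k², with μ small, dissipates: the
influence of a parent is absorbed by its own much heavier term (`sum_weighted_le`). Exponential
decay of this energy (`energy_decay`) makes both the phase-shift orbit and an open sublevel set
asymptotically stable. -/

/-! ### Pulses and their sums -/

/-- A smooth `2π`-periodic odd pulse, supported on the `2π`-translates of `[-ε, ε]`. -/
noncomputable def pulse (ε x : ℝ) : ℝ := sin x * expNegInvGlue (cos x - cos ε)

/-- A finite sum of translated pulses with centres `D` and weights `w`. -/
noncomputable def pulseSum (ε : ℝ) (D : Finset ℝ) (w : ℝ → ℝ) (x : ℝ) : ℝ :=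
  ∑ c ∈ D, w c * pulse ε (x - c)

lemma pulse_periodic (ε : ℝ) : Function.Periodic (pulse ε) (2 * π) := by
  intro x
  simp [pulse]

lemma pulseSum_periodic (ε : ℝ) (D : Finset ℝ) (w : ℝ → ℝ) :
    Function.Periodic (pulseSum ε D w) (2 * π) := by
  intro x
  unfold pulseSum
  refine Finset.sum_congr rfl fun c _ => ?_
  rw [add_sub_right_comm, pulse_periodic]

/-- The sum of pulses as a function on the circle. -/
noncomputable def pulseCoupling (ε : ℝ) (D : Finset ℝ) (w : ℝ → ℝ) : Torus1 → ℝ :=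
  (pulseSum_periodic ε D w).lift

@[simp]
lemma pulseCoupling_coe (ε : ℝ) (D : Finset ℝ) (w : ℝ → ℝ) (x : ℝ) :
    pulseCoupling ε D w (x : Torus1) = pulseSum ε D w x := rfl

@[simp]
lemma pulse_zero (ε : ℝ) : pulse ε 0 = 0 := by simp [pulse]

lemma pulse_eq_zero_of_cos_le {ε x : ℝ} (h : cos x ≤ cos ε) : pulse ε x = 0 := by
  rw [pulse, expNegInvGlue.zero_of_nonpos (by linarith), mul_zero]

lemma contDiff_pulse (ε : ℝ) {n : WithTop ℕ∞} (hn : n ≤ (⊤ : ℕ∞)) : ContDiff ℝ n (pulse ε) := by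
  unfold pulse
  have h : ContDiff ℝ (⊤ : ℕ∞) expNegInvGlue := expNegInvGlue.contDiff
  have h' := h.of_le hn
  exact Real.contDiff_sin.mul (h'.comp (Real.contDiff_cos.sub contDiff_const))

lemma contDiff_pulseSum (ε : ℝ) (D : Finset ℝ) (w : ℝ → ℝ) {n : WithTop ℕ∞}
    (hn : n ≤ (⊤ : ℕ∞)) : ContDiff ℝ n (pulseSum ε D w) := by
  unfold pulseSum
  refine ContDiff.sum fun c _ => contDiff_const.mul ?_
  exact (contDiff_pulse ε hn).comp (contDiff_id.sub contDiff_const)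

/-- The centres `D` lie in `[-π/3, π/3]` and are at least `2ε` apart. -/
structure IsSeparated (ε : ℝ) (D : Finset ℝ) : Prop where
  pos : 0 < ε
  le : ε ≤ π / 6
  abs_le : ∀ c ∈ D, |c| ≤ π / 3
  sep : ∀ c ∈ D, ∀ c' ∈ D, c ≠ c' → 2 * ε ≤ |c - c'|

lemma cos_lt_cos_of_lt_abs {ε y : ℝ} (hε : 0 < ε) (h : ε < |y|) (h' : |y| ≤ π) :
    cos y < cos ε := by
  rw [← cos_abs y]
  exact cos_lt_cos_of_nonneg_of_le_pi hε.le h' h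

lemma cos_lt_cos_of_abs_lt {ε y : ℝ} (hε : ε ≤ π) (h : |y| < ε) : cos ε < cos y := by
  rw [← cos_abs y]
  exact cos_lt_cos_of_nonneg_of_le_pi (abs_nonneg y) hε h

lemma abs_lt_of_cos_lt_cos {ε y : ℝ} (hε : 0 < ε) (h : cos ε < cos y) (h' : |y| ≤ π) :
    |y| < ε := by
  by_contra hc
  rw [not_lt] at hc
  have := cos_le_cos_of_nonneg_of_le_pi hε.le h' hc
  rw [cos_abs] at this
  linarith

/-- By the triangle inequality c + s - c' has absolute value above 2ε - ε = ε and below 2π/3 + π/6 <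
π, so it cannot wrap around the circle into the support of the pulse at c'. -/
lemma cos_lt_of_separated {ε c c' s : ℝ} (hε : 0 < ε) (hε' : ε ≤ π / 6) (hc : |c| ≤ π / 3)
    (hc' : |c'| ≤ π / 3) (h : 2 * ε ≤ |c - c'|) (hs : |s| < ε) : cos (c + s - c') < cos ε := by
  have e : c + s - c' = (c - c') + s := by ring
  have h1 : |c - c'| ≤ |c| + |c'| := abs_sub c c'
  have h2 : |c - c'| ≤ |c - c' + s| + |s| := by
    simpa using abs_sub (c - c' + s) s
  have h3 : |c - c' + s| ≤ |c - c'| + |s| := abs_add_le _ _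
  rw [e]
  have := pi_pos
  exact cos_lt_cos_of_lt_abs hε (by linarith) (by linarith)

lemma pulseSum_of_mem {ε : ℝ} {D : Finset ℝ} (hD : IsSeparated ε D) (w : ℝ → ℝ) {c s : ℝ}
    (hc : c ∈ D) (hs : |s| < ε) : pulseSum ε D w (c + s) = w c * pulse ε s := by
  rw [pulseSum, Finset.sum_eq_single_of_mem c hc]
  · simp
  · intro c' hc' hne
    rw [pulse_eq_zero_of_cos_le, mul_zero]
    exact (cos_lt_of_separated hD.pos hD.le (hD.abs_le c hc) (hD.abs_le c' hc')
      (hD.sep c hc c' hc' hne.symm) hs).le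

lemma pulseSum_eq_zero_of_forall_cos_le {ε : ℝ} {D : Finset ℝ} (w : ℝ → ℝ) {x : ℝ}
    (h : ∀ c ∈ D, cos (x - c) ≤ cos ε) : pulseSum ε D w x = 0 :=
  Finset.sum_eq_zero fun c hc => by rw [pulse_eq_zero_of_cos_le (h c hc), mul_zero]

lemma pulse_pos {ε s : ℝ} (hε : ε ≤ π) (h0 : 0 < s) (hs : s < ε) : 0 < pulse ε s := by
  refine mul_pos (sin_pos_of_pos_of_lt_pi h0 (by linarith)) (expNegInvGlue.pos_of_pos ?_)
  have := cos_lt_cos_of_abs_lt hε (by rwa [abs_of_pos h0])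
  linarith

/-- Inside the support the argument of `expNegInvGlue` is positive, so only its exponential branch
is seen. -/
lemma analyticOnNhd_pulse {ε : ℝ} (hε : ε ≤ π) : AnalyticOnNhd ℝ (pulse ε) (Ioo (-ε) ε) := by
  intro s hs
  have hs' : cos s - cos ε ≠ 0 :=
    (sub_pos.2 (cos_lt_cos_of_abs_lt hε (abs_lt.2 hs))).ne'
  have h1 : AnalyticAt ℝ (fun s => sin s * exp (-(cos s - cos ε)⁻¹)) s := by
    have hc : AnalyticAt ℝ (fun s => cos s - cos ε) s := by fun_prop
    exact (by fun_prop : AnalyticAt ℝ sin s).mul (hc.inv hs').neg.rexp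
  refine h1.congr ?_
  filter_upwards [Ioo_mem_nhds hs.1 hs.2] with y hy
  have := cos_lt_cos_of_abs_lt hε (abs_lt.2 hy)
  rw [pulse, expNegInvGlue, if_neg (by linarith)]

/-- The pulse is nowhere locally constant inside its support. -/
lemma not_eventually_pulse_eq {ε s C : ℝ} (hε : 0 < ε) (hε' : ε ≤ π) (hs : |s| < ε) :
    ¬ ∀ᶠ y in 𝓝 s, pulse ε y = C := by
  intro h
  -- Identity theorem: the pulse would be constant on the whole interval, but it is 0 at the centre
  -- and positive at ε/2.
  have key := (analyticOnNhd_pulse hε').eqOn_of_preconnected_of_eventuallyEq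
    (analyticOnNhd_const (v := C)) isPreconnected_Ioo (abs_lt.1 hs) h
  have h0 := key (x := 0) ⟨by linarith, hε⟩
  have h1 := key (x := ε / 2) ⟨by linarith, by linarith⟩
  have h2 := pulse_pos hε' (half_pos hε) (by linarith : ε / 2 < ε)
  simp only [pulse_zero] at h0
  simp only at h1
  linarith

/-! ### The dead zones of a sum of pulses -/

lemma isOpen_LC (g : Torus1 → ℝ) : IsOpen (LC g) := by
  rw [isOpen_iff_forall_mem_open]
  rintro x ⟨c, U, hU, hx, h⟩
  exact ⟨U, fun y hy => ⟨c, U, hU, hy, h⟩, hU, hx⟩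

lemma DZ_subset_LC (g : Torus1 → ℝ) : DZ g ⊆ LC g := fun _ ⟨U, hU, hx, h⟩ => ⟨0, U, hU, hx, h⟩

lemma continuous_coe_torus : Continuous (fun x : ℝ => (x : Torus1)) := AddCircle.continuous_mk' _

lemma exists_eq_add_zsmul_abs_le_pi (x : ℝ) : ∃ y : ℝ, |y| ≤ π ∧ ∃ n : ℤ, x = y + n * (2 * π) := by
  refine ⟨toIocMod two_pi_pos (-π) x, ?_, toIocDiv two_pi_pos (-π) x, ?_⟩
  · have := toIocMod_mem_Ioc two_pi_pos (-π) x
    rw [abs_le]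
    exact ⟨this.1.le, by linarith [this.2]⟩
  · have := toIocMod_add_toIocDiv_zsmul two_pi_pos (-π) x
    rw [zsmul_eq_mul] at this
    exact this.symm

lemma cos_le_of_mem_LC {ε : ℝ} {D : Finset ℝ} (hD : IsSeparated ε D) {w : ℝ → ℝ}
    (hw : ∀ c ∈ D, w c ≠ 0) {x : ℝ} (hx : (x : Torus1) ∈ LC (pulseCoupling ε D w)) {c : ℝ}
    (hc : c ∈ D) : cos (x - c) ≤ cos ε := by
  by_contra hlt
  rw [not_le] at hlt
  have hπ : ε ≤ π := by linarith [hD.le, pi_pos]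
  obtain ⟨s, hs, n, hn⟩ := exists_eq_add_zsmul_abs_le_pi (x - c)
  have hxs : (x : Torus1) = ((c + s : ℝ) : Torus1) := by
    have : x = c + s + n • (2 * π) := by rw [zsmul_eq_mul]; linarith
    rw [this, AddCircle.coe_add, AddCircle.coe_zsmul, AddCircle.coe_period]
    simp
  have hs' : |s| < ε := by
    refine abs_lt_of_cos_lt_cos hD.pos ?_ hs
    rwa [hn, cos_add_int_mul_two_pi] at hlt
  rw [hxs] at hx
  obtain ⟨C, U, hU, hxU, hC⟩ := hx
  apply not_eventually_pulse_eq (C := C / w c) hD.pos hπ hs'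
  have hcont : Continuous (fun y : ℝ => ((c + y : ℝ) : Torus1)) :=
    continuous_coe_torus.comp (by fun_prop)
  filter_upwards [(hU.preimage hcont).mem_nhds hxU,
    Ioo_mem_nhds (abs_lt.1 hs').1 (abs_lt.1 hs').2] with y hy hy'
  have := hC _ hy
  rw [pulseCoupling_coe, pulseSum_of_mem hD w hc (abs_lt.2 hy')] at this
  rw [← this]
  field_simp [hw c hc]

/-- Excludes the endpoints of a support. If equality held at x, then, `LC` being open, x would be a
local maximum of cos(· - c); so sin(x - c) = 0 and cos ε = ±1, contradicting 0 < ε < π. -/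
lemma cos_lt_of_mem_LC {ε : ℝ} {D : Finset ℝ} (hD : IsSeparated ε D) {w : ℝ → ℝ}
    (hw : ∀ c ∈ D, w c ≠ 0) {x : ℝ} (hx : (x : Torus1) ∈ LC (pulseCoupling ε D w)) {c : ℝ}
    (hc : c ∈ D) : cos (x - c) < cos ε := by
  refine lt_of_le_of_ne (cos_le_of_mem_LC hD hw hx hc) fun heq => ?_
  have hmax : IsLocalMax (fun y => cos (y - c)) x := by
    filter_upwards [((isOpen_LC _).preimage continuous_coe_torus).mem_nhds hx] with y hy
    rw [heq]
    exact cos_le_of_mem_LC hD hw hy hc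
  have hder : HasDerivAt (fun y => cos (y - c)) (-sin (x - c)) x := by
    simpa using ((hasDerivAt_id x).sub_const c).cos
  have h0 := hmax.hasDerivAt_eq_zero hder
  have h1 := sin_sq_add_cos_sq (x - c)
  have h2 := sin_sq_add_cos_sq ε
  have h3 : 0 < sin ε := sin_pos_of_pos_of_lt_pi hD.pos (by linarith [hD.le, pi_pos])
  rw [neg_eq_zero.1 h0, heq] at h1
  nlinarith

lemma mem_DZ_of_forall_cos_lt {ε : ℝ} {D : Finset ℝ} {w : ℝ → ℝ} {x : ℝ}
    (h : ∀ c ∈ D, cos (x - c) < cos ε) : (x : Torus1) ∈ DZ (pulseCoupling ε D w) := by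
  let V : Set ℝ := ⋂ c ∈ D, {y | cos (y - c) < cos ε}
  have hV : IsOpen V := isOpen_biInter_finset fun c _ =>
    isOpen_lt (by fun_prop) continuous_const
  refine ⟨(fun y : ℝ => (y : Torus1)) '' V, QuotientAddGroup.isOpenMap_coe _ hV,
    ⟨x, by simpa [V] using h, rfl⟩, ?_⟩
  rintro _ ⟨y, hy, rfl⟩
  simp only [V, mem_iInter, mem_ofPred_eq] at hy
  exact pulseSum_eq_zero_of_forall_cos_le w fun c hc => (hy c hc).le

lemma mem_DZ_pulseCoupling_iff {ε : ℝ} {D : Finset ℝ} (hD : IsSeparated ε D) {w : ℝ → ℝ}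
    (hw : ∀ c ∈ D, w c ≠ 0) (x : ℝ) :
    (x : Torus1) ∈ DZ (pulseCoupling ε D w) ↔ ∀ c ∈ D, cos (x - c) < cos ε :=
  ⟨fun h _ hc => cos_lt_of_mem_LC hD hw (DZ_subset_LC _ h) hc, mem_DZ_of_forall_cos_lt⟩

/-- A finite intersection of sets each of which is the complement of a closed interval is a finite
union of order-connected sets. -/
lemma exists_finite_ordConnected_cover (ε : ℝ) (D : Finset ℝ) :
    ∃ F : Set (Set ℝ), F.Finite ∧ (∀ s ∈ F, s.OrdConnected) ∧
      ⋃₀ F = Icc (-π) π ∩ {x | ∀ c ∈ D, ε < |x - c|} := by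
  induction D using Finset.induction_on with
  | empty => exact ⟨{Icc (-π) π}, finite_singleton _, by simp [ordConnected_Icc], by simp⟩
  | insert c D _ ih =>
    obtain ⟨F, hF, hord, hU⟩ := ih
    -- Removing [c - ε, c + ε] cuts each piece into a left and a right part.
    refine ⟨(fun s => s ∩ Iio (c - ε)) '' F ∪ (fun s => s ∩ Ioi (c + ε)) '' F,
      (hF.image _).union (hF.image _), ?_, ?_⟩
    · rintro _ (⟨s, hs, rfl⟩ | ⟨s, hs, rfl⟩)
      · exact (hord s hs).inter ordConnected_Iio
      · exact (hord s hs).inter ordConnected_Ioi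
    · have e : Icc (-π) π ∩ {x | ∀ c' ∈ insert c D, ε < |x - c'|} =
          (⋃₀ F) ∩ (Iio (c - ε) ∪ Ioi (c + ε)) := by
        rw [hU]
        ext x
        simp only [mem_inter_iff, mem_ofPred_eq, Finset.forall_mem_insert, mem_union, mem_Iio,
          mem_Ioi, lt_abs]
        constructor
        · rintro ⟨h1, h2 | h2, h3⟩
          · exact ⟨⟨h1, h3⟩, Or.inr (by linarith)⟩
          · exact ⟨⟨h1, h3⟩, Or.inl (by linarith)⟩
        · rintro ⟨⟨h1, h3⟩, h2 | h2⟩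
          · exact ⟨h1, Or.inr (by linarith), h3⟩
          · exact ⟨h1, Or.inl (by linarith), h3⟩
      rw [e, sUnion_union, sUnion_image, sUnion_image, inter_union_distrib_left,
        sUnion_eq_biUnion, iUnion₂_inter, iUnion₂_inter]

/-- Assign to each component a piece of the cover that meets it. Components meeting the same
preconnected piece coincide, so the assignment is injective. -/
lemma finite_connectedComponents_of_cover {X : Type*} [TopologicalSpace X] {S : Set X}
    {F : Set (Set X)} (hF : F.Finite) (hconn : ∀ s ∈ F, IsPreconnected s) (hU : ⋃₀ F = S) :
    Finite (ConnectedComponents S) := by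
  have := hF.to_subtype
  have hrep : ∀ q : ConnectedComponents S, ∃ x : S, (x : ConnectedComponents S) = q ∧
      ∃ s : F, (x : X) ∈ (s : Set X) := fun q => by
    obtain ⟨x, rfl⟩ := ConnectedComponents.surjective_coe q
    obtain ⟨s, hs, hx⟩ : (x : X) ∈ ⋃₀ F := hU ▸ x.2
    exact ⟨x, rfl, ⟨s, hs⟩, hx⟩
  choose x hx f hf using hrep
  refine Finite.of_injective f fun q q' h => ?_
  have hs : IsPreconnected ((↑) ⁻¹' (f q : Set X) : Set S) := by
    rw [← Topology.IsInducing.subtypeVal.isPreconnected_image, Subtype.image_preimage_coe,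
      inter_eq_right.2]
    · exact hconn _ (f q).2
    · rw [← hU]
      exact subset_sUnion_of_mem (f q).2
  have hq' : x q' ∈ ((↑) ⁻¹' (f q : Set X) : Set S) := by
    rw [h]
    exact hf q'
  rw [← hx q, ← hx q']
  exact ConnectedComponents.coe_eq_coe'.2 (hs.subset_connectedComponent hq' (hf q))

/-- Monotonicity of cos settles |x - c| ≤ π. Beyond that, |x - c| ≤ 4π/3 < 3π/2, where cos is
negative while cos ε > 0. -/
lemma cos_lt_cos_iff_of_abs_le {ε c x : ℝ} (hε : 0 < ε) (hε' : ε ≤ π / 6) (hc : |c| ≤ π / 3)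
    (hx : |x| ≤ π) : cos (x - c) < cos ε ↔ ε < |x - c| := by
  have h1 : |x - c| ≤ |x| + |c| := abs_sub x c
  have := pi_pos
  constructor
  · intro h
    by_contra hc
    rw [not_lt] at hc
    have := cos_le_cos_of_nonneg_of_le_pi (abs_nonneg _) (by linarith) hc
    rw [cos_abs] at this
    linarith
  · intro h
    rcases le_or_gt |x - c| π with h2 | h2
    · exact cos_lt_cos_of_lt_abs hε h h2
    · have h3 : cos (x - c) < 0 := by
        rw [← cos_abs]
        exact cos_neg_of_pi_div_two_lt_of_lt (by linarith) (by linarith)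
      have h4 : 0 < cos ε := cos_pos_of_mem_Ioo ⟨by linarith, by linarith⟩
      linarith

lemma finite_connectedComponents_DZ {ε : ℝ} {D : Finset ℝ} (hD : IsSeparated ε D) {w : ℝ → ℝ}
    (hw : ∀ c ∈ D, w c ≠ 0) : Finite (ConnectedComponents (DZ (pulseCoupling ε D w))) := by
  obtain ⟨F, hF, hord, hU⟩ := exists_finite_ordConnected_cover ε D
  refine finite_connectedComponents_of_cover
    (hF.image fun s => (fun y : ℝ => (y : Torus1)) '' s) ?_ ?_
  · rintro _ ⟨s, hs, rfl⟩
    exact (hord s hs).isPreconnected.image _ continuous_coe_torus.continuousOn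
  · rw [← image_sUnion, hU]
    ext z
    constructor
    · rintro ⟨x, ⟨hx, h⟩, rfl⟩
      refine mem_DZ_of_forall_cos_lt fun c hc => ?_
      exact (cos_lt_cos_iff_of_abs_le hD.pos hD.le (hD.abs_le c hc) (abs_le.2 hx)).2 (h c hc)
    · intro hz
      obtain ⟨x₀, rfl⟩ := QuotientAddGroup.mk_surjective z
      obtain ⟨x, hx, n, rfl⟩ := exists_eq_add_zsmul_abs_le_pi x₀
      have e : ((x + n * (2 * π) : ℝ) : Torus1) = (x : Torus1) := by
        rw [← zsmul_eq_mul, AddCircle.coe_add, AddCircle.coe_zsmul, AddCircle.coe_period]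
        simp
      refine ⟨x, ⟨abs_le.1 hx, fun c hc => ?_⟩, e.symm⟩
      have hz' : (x : Torus1) ∈ DZ (pulseCoupling ε D w) := e ▸ hz
      exact (cos_lt_cos_iff_of_abs_le hD.pos hD.le (hD.abs_le c hc) hx).1
        ((mem_DZ_pulseCoupling_iff hD hw x).1 hz' c hc)

lemma isCouplingFunction_pulseCoupling {ε : ℝ} {D : Finset ℝ} (hD : IsSeparated ε D)
    (hne : D.Nonempty) {w : ℝ → ℝ} (hw : ∀ c ∈ D, w c ≠ 0) :
    IsCouplingFunction (pulseCoupling ε D w) where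
  smooth := contDiff_pulseSum ε D w le_rfl
  nonconstant := by
    rintro ⟨C, hC⟩
    obtain ⟨c, hc⟩ := hne
    have h : (c : Torus1) ∈ LC (pulseCoupling ε D w) :=
      ⟨C, univ, isOpen_univ, mem_univ _, fun y _ => hC y⟩
    have := cos_le_of_mem_LC hD hw h hc
    have h' := cos_lt_cos_of_abs_lt (ε := ε) (y := 0) (by linarith [hD.le, pi_pos])
      (by simpa using hD.pos)
    rw [sub_self] at this
    linarith
  finite_deadZones := finite_connectedComponents_DZ hD hw
  locallyConstant_eq := by
    refine Subset.antisymm (fun z hz => ?_) (DZ_subset_LC _)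
    obtain ⟨x, rfl⟩ := QuotientAddGroup.mk_surjective z
    exact mem_DZ_of_forall_cos_lt fun c hc => cos_lt_of_mem_LC hD hw hz hc

/-- On half of its support the pulse lies between two lines through the origin. -/
lemma exists_pulse_slope {ε : ℝ} (hε : 0 < ε) (hε' : ε ≤ π / 6) :
    ∃ a₀ : ℝ, 0 < a₀ ∧ a₀ ≤ 1 ∧ ∀ s, |s| ≤ ε / 2 → ∃ a, a₀ ≤ a ∧ a ≤ 1 ∧ pulse ε s = a * s := by
  have hπ := pi_pos
  have hE1 : ∀ x, expNegInvGlue x ≤ 1 := fun x => by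
    rw [expNegInvGlue]
    split_ifs with h
    · exact zero_le_one
    · rw [exp_le_one_iff, neg_nonpos]
      exact inv_nonneg.2 (not_le.1 h).le
  have hpos : 0 < expNegInvGlue (cos (ε / 2) - cos ε) := by
    refine expNegInvGlue.pos_of_pos (sub_pos.2 (cos_lt_cos_of_abs_lt (by linarith) ?_))
    rw [abs_of_pos (by linarith)]
    linarith
  have hmono : ∀ s, |s| ≤ ε / 2 →
      expNegInvGlue (cos (ε / 2) - cos ε) ≤ expNegInvGlue (cos s - cos ε) := fun s hs => by
    apply expNegInvGlue.monotone
    have := cos_le_cos_of_nonneg_of_le_pi (abs_nonneg s) (by linarith) hs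
    rw [cos_abs] at this
    linarith
  have h2π : 2 / π ≤ 1 := by
    rw [div_le_one hπ]
    exact two_le_pi
  refine ⟨2 / π * expNegInvGlue (cos (ε / 2) - cos ε), by positivity,
    mul_le_one₀ h2π hpos.le (hE1 _), fun s hs => ?_⟩
  -- The slope a is sinc s times the exponential factor. Jordan's inequality bounds the first from
  -- below, and monotonicity, with its minimum at |s| = ε/2, bounds the second.
  have hsinc : 2 / π ≤ sinc s ∧ sinc s ≤ 1 := by
    refine ⟨?_, sinc_le_one s⟩
    have habs : ∀ t, 0 ≤ t → t ≤ ε / 2 → 2 / π ≤ sinc t := fun t h0 ht => by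
      rcases h0.eq_or_lt with rfl | h0
      · simpa using h2π
      · rw [sinc_of_ne_zero h0.ne', le_div_iff₀ h0]
        exact mul_le_sin h0.le (by linarith)
    rcases le_total 0 s with h | h
    · exact habs s h (by rwa [abs_of_nonneg h] at hs)
    · rw [← sinc_neg]
      exact habs _ (by linarith) (by rwa [abs_of_nonpos h] at hs)
  refine ⟨sinc s * expNegInvGlue (cos s - cos ε), ?_, ?_, ?_⟩
  · exact mul_le_mul hsinc.1 (hmono s hs) hpos.le (le_trans (by positivity) hsinc.1)
  · exact mul_le_one₀ hsinc.2 (expNegInvGlue.nonneg _) (hE1 _)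
  · rcases eq_or_ne s 0 with rfl | h
    · simp
    · rw [sinc_of_ne_zero h, pulse]
      field_simp

/-! ### Diverging trees -/

/-- A diverging tree has a root, a parent map and a depth function. -/
lemma IsDivergingTree.exists_depth {V : Type*} {T : Digraph V} (hT : IsDivergingTree T) :
    ∃ (r : V) (par : V → V) (depth : V → ℕ), (∀ j, ¬ T.Adj j r) ∧
      (∀ k, k ≠ r → ∀ j, T.Adj j k ↔ j = par k) ∧
      (∀ k, k ≠ r → depth k = depth (par k) + 1) := by
  classical
  obtain ⟨hconn, r, hr, hpar⟩ := hT
  have hpar' : ∀ k, ∃ p, (k = r → p = r) ∧ (k ≠ r → ∀ j, T.Adj j k ↔ j = p) := fun k => by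
    by_cases hk : k = r
    · exact ⟨r, fun _ => rfl, fun h => absurd hk h⟩
    · obtain ⟨p, hp, hu⟩ := hpar k hk
      exact ⟨p, fun h => absurd h hk, fun _ j => ⟨hu j, fun h => h ▸ hp⟩⟩
  choose par hroot hadj using hpar'
  have hstep : ∀ j k, T.Adj j k → par k = j := fun j k h => by
    have hk : k ≠ r := fun e => hr j (e ▸ h)
    exact ((hadj k hk j).1 h).symm
  -- Induction along an undirected walk to the root: each step goes either to the parent, adding one
  -- iterate, or to a child, whose path to the root passes back through the present node.
  have hreach : ∀ k, ∃ n, par^[n] k = r := by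
    intro k
    obtain ⟨walk⟩ := hconn.preconnected k r
    induction walk with
    | nil => exact ⟨0, rfl⟩
    | @cons u v x huv _ ih =>
      obtain ⟨n, hn⟩ := ih hr hpar hroot hadj
      rw [Digraph.toSimpleGraphInclusive, SimpleGraph.fromRel_adj] at huv
      rcases huv.2 with h | h
      · have hv := hstep _ _ h
        cases n with
        | zero =>
          simp only [Function.iterate_zero, id] at hn
          exact absurd h (hn ▸ hr u)
        | succ n => exact ⟨n, by rwa [Function.iterate_succ_apply, hv] at hn⟩
      · exact ⟨n + 1, by rw [Function.iterate_succ_apply, hstep _ _ h, hn]⟩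
  refine ⟨r, par, fun k => Nat.find (hreach k), hr, hadj, fun k hk => ?_⟩
  rw [Nat.find_eq_iff]
  refine ⟨by simpa using Nat.find_spec (hreach (par k)), fun m hm h => ?_⟩
  cases m with
  | zero => exact hk h
  | succ m => exact Nat.find_min (hreach (par k)) (Nat.lt_of_succ_lt_succ hm) h

/-! ### Phases with distinct differences -/

/-- The larger exponent is determined by the sum: if a > c ≥ d, then 3^a already exceeds 3^c + 3^d.
-/
lemma three_pow_add_injective {a b c d : ℕ} (h : 3 ^ a + 3 ^ b = 3 ^ c + 3 ^ d) :
    (a = c ∧ b = d) ∨ (a = d ∧ b = c) := by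
  have aux : ∀ {a b c d : ℕ}, b ≤ a → d ≤ c → 3 ^ a + 3 ^ b = 3 ^ c + 3 ^ d → a ≤ c := by
    intro a b c d _ hdc h
    by_contra hlt
    have h1 : 3 ^ (c + 1) ≤ 3 ^ a := Nat.pow_le_pow_right (by norm_num) (by omega)
    have h2 : 3 ^ d ≤ 3 ^ c := Nat.pow_le_pow_right (by norm_num) hdc
    have h3 : 0 < 3 ^ b := by positivity
    have h4 : 0 < 3 ^ c := by positivity
    rw [pow_succ] at h1
    omega
  have key : ∀ {a b c d : ℕ}, b ≤ a → d ≤ c → 3 ^ a + 3 ^ b = 3 ^ c + 3 ^ d → a = c ∧ b = d := by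
    intro a b c d hba hdc h
    have e : a = c := le_antisymm (aux hba hdc h) (aux hdc hba h.symm)
    subst e
    exact ⟨rfl, Nat.pow_right_injective (by norm_num : 2 ≤ 3) (by simpa using h)⟩
  rcases le_total b a with h1 | h1 <;> rcases le_total d c with h2 | h2
  · exact Or.inl (key h1 h2 h)
  · exact Or.inr (key h1 h2 (by omega))
  · obtain ⟨h3, h4⟩ := key h1 h2 (by omega)
    exact Or.inr ⟨h4, h3⟩
  · obtain ⟨h3, h4⟩ := key h1 h2 (by omega)
    exact Or.inl ⟨h4, h3⟩

/-- Phases on the real line all of whose differences are distinct. -/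
noncomputable def sidonPhase (N : ℕ) (k : Fin N) : ℝ := π * 3 ^ (k : ℕ) / 3 ^ N

/-- Half the minimal gap between the differences of the phases `sidonPhase`. -/
noncomputable def sidonGap (N : ℕ) : ℝ := π / (2 * 3 ^ N)

lemma sidonGap_pos (N : ℕ) : 0 < sidonGap N := by
  unfold sidonGap
  positivity

lemma sidonGap_le {N : ℕ} (hN : N ≠ 0) : sidonGap N ≤ π / 6 := by
  unfold sidonGap
  have : (3 : ℝ) ^ 1 ≤ 3 ^ N := pow_le_pow_right₀ (by norm_num) (Nat.one_le_iff_ne_zero.2 hN)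
  exact div_le_div_of_nonneg_left pi_pos.le (by norm_num) (by linarith)

lemma sidonPhase_mem {N : ℕ} (k : Fin N) : sidonPhase N k ∈ Icc 0 (π / 3) := by
  unfold sidonPhase
  refine ⟨by positivity, ?_⟩
  rw [div_le_div_iff₀ (by positivity) (by norm_num), mul_assoc, ← pow_succ]
  have : (3 : ℝ) ^ ((k : ℕ) + 1) ≤ 3 ^ N := pow_le_pow_right₀ (by norm_num) k.2
  exact mul_le_mul_of_nonneg_left this pi_pos.le

lemma abs_sidonPhase_sub_le {N : ℕ} (j k : Fin N) : |sidonPhase N j - sidonPhase N k| ≤ π / 3 := by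
  obtain ⟨h1, h2⟩ := sidonPhase_mem j
  obtain ⟨h3, h4⟩ := sidonPhase_mem k
  rw [abs_le]
  constructor <;> linarith

/-- All differences are integer multiples of twice the gap, so distinct ones are at least that far
apart. -/
lemma sidonPhase_sub_eq {N : ℕ} (j k : Fin N) : sidonPhase N j - sidonPhase N k =
    2 * sidonGap N * ((3 ^ (j : ℕ) - 3 ^ (k : ℕ) : ℤ) : ℝ) := by
  unfold sidonPhase sidonGap
  push_cast
  field_simp

lemma sidonPhase_sub_injective {N : ℕ} {j k j' k' : Fin N} (hjk : j ≠ k)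
    (h : sidonPhase N j - sidonPhase N k = sidonPhase N j' - sidonPhase N k') :
    j = j' ∧ k = k' := by
  rw [sidonPhase_sub_eq, sidonPhase_sub_eq] at h
  have h1 := mul_left_cancel₀ (mul_pos two_pos (sidonGap_pos N)).ne' h
  have h2 : (3 : ℤ) ^ (j : ℕ) - 3 ^ (k : ℕ) = 3 ^ (j' : ℕ) - 3 ^ (k' : ℕ) := by exact_mod_cast h1
  have h3 : (3 : ℤ) ^ (j : ℕ) + 3 ^ (k' : ℕ) = 3 ^ (j' : ℕ) + 3 ^ (k : ℕ) := by linarith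
  have h4 : 3 ^ (j : ℕ) + 3 ^ (k' : ℕ) = 3 ^ (j' : ℕ) + 3 ^ (k : ℕ) := by exact_mod_cast h3
  rcases three_pow_add_injective h4 with ⟨h5, h6⟩ | ⟨h5, h6⟩
  · exact ⟨Fin.ext h5, Fin.ext h6.symm⟩
  · exact absurd (Fin.ext h5) hjk

lemma two_sidonGap_le_of_ne {N : ℕ} {j k j' k' : Fin N}
    (h : sidonPhase N j - sidonPhase N k ≠ sidonPhase N j' - sidonPhase N k') :
    2 * sidonGap N ≤ |sidonPhase N j - sidonPhase N k - (sidonPhase N j' - sidonPhase N k')| := by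
  have hg := sidonGap_pos N
  rw [sidonPhase_sub_eq, sidonPhase_sub_eq, ← mul_sub, abs_mul, abs_of_pos (by linarith)]
  rw [sidonPhase_sub_eq, sidonPhase_sub_eq] at h
  refine le_mul_of_one_le_right (by linarith) ?_
  rw [← Int.cast_sub, ← Int.cast_abs]
  have : (3 ^ (j : ℕ) - 3 ^ (k : ℕ) : ℤ) - (3 ^ (j' : ℕ) - 3 ^ (k' : ℕ)) ≠ 0 := fun e =>
    h (by rw [sub_eq_zero.1 e])
  exact_mod_cast Int.one_le_abs this

/-! ### A quadratic Lyapunov function -/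

lemma exp_decay_of_deriv_le {V V' : ℝ → ℝ} {R c : ℝ} (hc : 0 < c)
    (hV : ∀ t ∈ Ici (0 : ℝ), HasDerivWithinAt V (V' t) (Ici 0) t) (hnn : ∀ t, 0 ≤ V t)
    (h0 : V 0 < R) (hle : ∀ t ∈ Ici (0 : ℝ), V t < R → V' t ≤ -c * V t) {t : ℝ} (ht : 0 ≤ t) :
    V t ≤ V 0 * exp (-c * t) := by
  have hcont : ContinuousOn V (Ici 0) := fun t ht => (hV t ht).continuousWithinAt
  have hlt : ∀ t ∈ Ici (0 : ℝ), V t < R := by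
    intro t ht
    -- The barrier is a level strictly below R, where the dissipation hypothesis still applies: V
    -- has negative derivative whenever it equals R', so it cannot cross.
    obtain ⟨R', h1, h2⟩ := exists_between h0
    refine lt_of_le_of_lt ?_ h2
    refine image_le_of_deriv_right_lt_deriv_boundary (f := V) (f' := V') (a := 0) (b := t)
      (B := fun _ => R') (B' := fun _ => 0) (hcont.mono Icc_subset_Ici_self)
      (fun x hx => (hV x hx.1).mono (Ici_subset_Ici.2 hx.1)) h1.le
      (fun x => hasDerivAt_const x R') ?_ (right_mem_Icc.2 ht)
    intro x hx hxR
    have h3 : 0 < R' := (hnn 0).trans_lt h1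
    have h4 := hle x hx.1 (hxR ▸ h2)
    rw [hxR] at h4
    nlinarith
  have hexp : ∀ s, HasDerivAt (fun s => exp (c * s)) (exp (c * s) * c) s := fun s => by
    simpa using ((hasDerivAt_id s).const_mul c).exp
  have hanti : AntitoneOn (fun s => V s * exp (c * s)) (Ici 0) := by
    refine antitoneOn_of_hasDerivWithinAt_nonpos (convex_Ici 0)
      (f' := fun s => V' s * exp (c * s) + V s * (exp (c * s) * c)) ?_ ?_ ?_
    · exact hcont.mul (by fun_prop)
    · intro x hx
      exact ((hV x (interior_subset hx)).mul (hexp x).hasDerivWithinAt).mono interior_subset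
    · intro x hx
      have h1 := hle x (interior_subset hx) (hlt x (interior_subset hx))
      have h2 := exp_pos (c * x)
      nlinarith
  have := hanti self_mem_Ici ht ht
  simp only [mul_zero, exp_zero, mul_one] at this
  rw [neg_mul, exp_neg, ← div_eq_mul_inv, le_div_iff₀ (exp_pos _)]
  exact this

/-- A perturbation of the consensus dynamics on a diverging tree dissipates a weighted sum of
squares, if the weights decrease fast enough away from the root. -/
lemma sum_weighted_le {V : Type*} [Fintype V] {r : V} {par : V → V} {p x v : V → ℝ}
    {μ a₀ η m : ℝ} (hm : 0 < m) (hpm : ∀ k, m ≤ p k) (hp1 : ∀ k, p k ≤ 1) (hμ : 0 ≤ μ)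
    (hη : 0 ≤ η) (hpar : ∀ k, k ≠ r → p k ≤ μ * p (par k))
    (hμa : Fintype.card V * μ ≤ a₀ / 2) (hηa : 6 * Fintype.card V * η ≤ a₀ / 4 * m)
    (hxr : x r = 0)
    (hv : ∀ k, k ≠ r → ∃ a, a₀ ≤ a ∧ a ≤ 1 ∧ 0 ≤ a ∧
      |v k - a * (x (par k) - x k)| ≤ η * ∑ j, (2 * |x j| + |x k|)) :
    ∑ k, p k * (2 * x k * v k) ≤ -(a₀ / 4) * ∑ k, p k * x k ^ 2 := by
  classical
  set W := ∑ k, p k * x k ^ 2 with hW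
  set Q := ∑ k, x k ^ 2 with hQ
  set n : ℝ := (Fintype.card V : ℝ) with hn
  have hp0 : ∀ k, 0 ≤ p k := fun k => hm.le.trans (hpm k)
  have hn0 : 0 ≤ n := Nat.cast_nonneg _
  have hQ0 : 0 ≤ Q := Finset.sum_nonneg fun k _ => sq_nonneg _
  have hterm : ∀ k, p k * (2 * x k * v k) ≤
      μ * W - a₀ * (p k * x k ^ 2) + η * (4 * n * x k ^ 2 + 2 * Q) := by
    intro k
    have hW0 : 0 ≤ W := Finset.sum_nonneg fun k _ => mul_nonneg (hp0 k) (sq_nonneg _)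
    by_cases hk : k = r
    · rw [hk, hxr]
      have : 0 ≤ μ * W := mul_nonneg hμ hW0
      have : 0 ≤ η * (4 * n * 0 ^ 2 + 2 * Q) := by positivity
      simp only [mul_zero, zero_mul, ne_eq, OfNat.ofNat_ne_zero, not_false_eq_true, zero_pow]
        at *
      linarith
    · obtain ⟨a, ha0, ha1, hann, ha⟩ := hv k hk
      set E := v k - a * (x (par k) - x k) with hE
      -- From 2xy ≤ x² + y² and a₀ ≤ a ≤ 1.
      have h1 : 2 * x k * (a * (x (par k) - x k)) ≤ x (par k) ^ 2 - a₀ * x k ^ 2 := by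
        nlinarith [mul_nonneg hann (sq_nonneg (x (par k) - x k)), sq_nonneg (x k),
          sq_nonneg (x (par k)), mul_le_mul_of_nonneg_right ha0 (sq_nonneg (x k)),
          mul_le_mul_of_nonneg_right ha1 (sq_nonneg (x (par k)))]
      have h2 : 2 * x k * E ≤ η * (4 * n * x k ^ 2 + 2 * Q) := by
        calc 2 * x k * E ≤ 2 * |x k| * |E| := by
              rw [mul_assoc, mul_assoc, ← abs_mul]
              linarith [le_abs_self (x k * E)]
          _ ≤ 2 * |x k| * (η * ∑ j, (2 * |x j| + |x k|)) := by gcongr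
          _ = η * ∑ j, 2 * |x k| * (2 * |x j| + |x k|) := by rw [← Finset.mul_sum]; ring
          _ ≤ η * ∑ j, (2 * x j ^ 2 + 4 * x k ^ 2) := by
              gcongr with j
              nlinarith [sq_nonneg (|x k| - |x j|), sq_abs (x j), sq_abs (x k)]
          _ = η * (4 * n * x k ^ 2 + 2 * Q) := by
              rw [Finset.sum_add_distrib, ← Finset.mul_sum, Finset.sum_const, Finset.card_univ,
                nsmul_eq_mul]
              ring
      -- The weight drops by a factor μ from parent to child, so the parent's term costs only a
      -- fraction μ of the energy.
      have h3 : p k * x (par k) ^ 2 ≤ μ * W := by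
        calc p k * x (par k) ^ 2 ≤ μ * p (par k) * x (par k) ^ 2 := by
              gcongr
              exact hpar k hk
          _ = μ * (p (par k) * x (par k) ^ 2) := by ring
          _ ≤ μ * W := by
              gcongr
              exact Finset.single_le_sum (f := fun k => p k * x k ^ 2)
                (fun k _ => mul_nonneg (hp0 k) (sq_nonneg _)) (Finset.mem_univ (par k))
      have h4 : 0 ≤ η * (4 * n * x k ^ 2 + 2 * Q) := by positivity
      have h5 : v k = a * (x (par k) - x k) + E := by rw [hE]; ring
      have h6 := mul_le_mul_of_nonneg_left h1 (hp0 k)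
      have h7 := mul_le_mul_of_nonneg_left h2 (hp0 k)
      have h8 := mul_le_mul_of_nonneg_right (hp1 k) h4
      rw [h5]
      nlinarith
  have hsum : ∑ k, p k * (2 * x k * v k) ≤ n * (μ * W) - a₀ * W + η * (6 * n * Q) := by
    calc ∑ k, p k * (2 * x k * v k)
        ≤ ∑ k, (μ * W - a₀ * (p k * x k ^ 2) + η * (4 * n * x k ^ 2 + 2 * Q)) :=
          Finset.sum_le_sum fun k _ => hterm k
      _ = n * (μ * W) - a₀ * W + η * (6 * n * Q) := by
          rw [Finset.sum_add_distrib, Finset.sum_sub_distrib, ← Finset.mul_sum, ← Finset.mul_sum,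
            ← Finset.mul_sum, Finset.sum_add_distrib, ← Finset.mul_sum, Finset.sum_const,
            Finset.sum_const, Finset.card_univ, nsmul_eq_mul, nsmul_eq_mul]
          ring
  have hmQ : m * Q ≤ W := by
    rw [hQ, Finset.mul_sum]
    exact Finset.sum_le_sum fun k _ => mul_le_mul_of_nonneg_right (hpm k) (sq_nonneg _)
  have hW0 : 0 ≤ W := (mul_nonneg hm.le hQ0).trans hmQ
  have ha0 : 0 ≤ a₀ := by
    have : 0 ≤ n * μ := mul_nonneg hn0 hμ
    linarith
  have e1 := mul_le_mul_of_nonneg_right hμa hW0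
  have e2 := mul_le_mul_of_nonneg_right hηa hQ0
  have e3 := mul_le_mul_of_nonneg_left hmQ (by linarith : 0 ≤ a₀ / 4)
  -- Parents contribute at most a₀/2 · W and the weak edges at most a₀/4 · W, against the
  -- dissipation a₀ · W; a₀/4 · W is left.
  nlinarith

/-- The weighted sum of squares dissipates in a network whose tree edges have strength `1` and whose
other edges are weak, if the coupling lies between two lines of positive slope. -/
lemma sum_weighted_network_le {V : Type*} [Fintype V] {r : V} {par : V → V} {p x : V → ℝ}
    {e : V → V → ℝ} {P : ℝ → ℝ} {μ a₀ η m R : ℝ} (hm : 0 < m) (hpm : ∀ k, m ≤ p k)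
    (hp1 : ∀ k, p k ≤ 1) (hμ : 0 ≤ μ) (ha₀ : 0 ≤ a₀) (hη : 0 ≤ η)
    (hpar : ∀ k, k ≠ r → p k ≤ μ * p (par k))
    (hμa : Fintype.card V * μ ≤ a₀ / 2) (hηa : 6 * Fintype.card V * η ≤ a₀ / 4 * m)
    (he : ∀ k, k ≠ r → e (par k) k = 1)
    (he' : ∀ j k, (k = r ∨ j ≠ par k) → 0 ≤ e j k ∧ e j k ≤ η)
    (hP : ∀ s, |s| ≤ R → ∃ a, a₀ ≤ a ∧ a ≤ 1 ∧ P s = a * s)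
    (hx : ∀ k, |x k| ≤ R / 2) (hxr : x r = 0) :
    ∑ k, p k * (2 * x k * (∑ j, e j k * P (x j - x k) - ∑ j, e j r * P (x j - x r))) ≤
      -(a₀ / 4) * ∑ k, p k * x k ^ 2 := by
  classical
  have hd : ∀ j k, |x j - x k| ≤ R := fun j k => by
    linarith [abs_sub (x j) (x k), hx j, hx k]
  have hPle : ∀ j k, |P (x j - x k)| ≤ |x j| + |x k| := fun j k => by
    obtain ⟨a, h0, h1, h2⟩ := hP _ (hd j k)
    rw [h2, abs_mul, abs_of_nonneg (ha₀.trans h0)]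
    calc a * |x j - x k| ≤ 1 * |x j - x k| := by gcongr
      _ ≤ |x j| + |x k| := by rw [one_mul]; exact abs_sub _ _
  have hterm : ∀ j k, (k = r ∨ j ≠ par k) → |e j k * P (x j - x k)| ≤ η * (|x j| + |x k|) :=
    fun j k h => by
      rw [abs_mul, abs_of_nonneg (he' j k h).1]
      exact mul_le_mul (he' j k h).2 (hPle j k) (abs_nonneg _) hη
  refine sum_weighted_le hm hpm hp1 hμ hη hpar hμa hηa hxr fun k hk => ?_
  obtain ⟨a, h0, h1, h2⟩ := hP _ (hd (par k) k)
  refine ⟨a, h0, h1, ha₀.trans h0, ?_⟩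
  rw [← Finset.add_sum_erase _ _ (Finset.mem_univ (par k)), he k hk, one_mul, h2]
  -- The error has two sources: the weak edges into k, and the edges into the root, whose velocity
  -- is subtracted. All edges into the root are weak, since it has no tree parent.
  have e1 : |∑ j ∈ Finset.univ.erase (par k), e j k * P (x j - x k)| ≤
      ∑ j, η * (|x j| + |x k|) := by
    refine (Finset.abs_sum_le_sum_abs _ _).trans ((Finset.sum_le_sum fun j hj =>
      hterm j k (Or.inr (Finset.ne_of_mem_erase hj))).trans ?_)
    exact Finset.sum_le_sum_of_subset_of_nonneg (Finset.erase_subset _ _)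
      fun j _ _ => by positivity
  have e2 : |∑ j, e j r * P (x j - x r)| ≤ ∑ j, η * |x j| := by
    refine (Finset.abs_sum_le_sum_abs _ _).trans (Finset.sum_le_sum fun j _ => ?_)
    simpa [hxr] using hterm j r (Or.inl rfl)
  have e3 : η * ∑ j, (2 * |x j| + |x k|) = ∑ j, η * (|x j| + |x k|) + ∑ j, η * |x j| := by
    rw [← Finset.sum_add_distrib, Finset.mul_sum]
    exact Finset.sum_congr rfl fun j _ => by ring
  rw [e3]
  refine le_trans (le_of_eq ?_) ((abs_sub _ _).trans (add_le_add e1 e2))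
  congr 1
  ring

/-! ### The energy on the torus -/

/-- The deviation of the phase of the oscillator `k`, relative to that of the oscillator `r`, from
its value at `ψ`. -/
noncomputable def deviation {N : ℕ} (ψ : Fin N → ℝ) (r : Fin N) (θ : Phases N) (k : Fin N) :
    Torus1 :=
  θ k - θ r - ((ψ k - ψ r : ℝ) : Torus1)

/-- The weighted sum of squares of the deviations from `ψ`. -/
noncomputable def energy {N : ℕ} (ψ : Fin N → ℝ) (r : Fin N) (p : Fin N → ℝ) (θ : Phases N) : ℝ :=
  ∑ k, p k * ‖deviation ψ r θ k‖ ^ 2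

lemma continuous_energy {N : ℕ} (ψ : Fin N → ℝ) (r : Fin N) (p : Fin N → ℝ) :
    Continuous (energy ψ r p) := by
  unfold energy deviation
  fun_prop

lemma exists_coe_eq_abs_eq_norm (z : Torus1) : ∃ y : ℝ, (y : Torus1) = z ∧ |y| = ‖z‖ := by
  obtain ⟨x, rfl⟩ := QuotientAddGroup.mk_surjective z
  refine ⟨x - round ((2 * π)⁻¹ * x) * (2 * π), ?_, (AddCircle.norm_eq (2 * π)).symm⟩
  rw [← zsmul_eq_mul, AddCircle.coe_sub, AddCircle.coe_zsmul, AddCircle.coe_period]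
  simp

lemma norm_coe_torus_le (x : ℝ) : ‖(x : Torus1)‖ ≤ |x| := by
  simpa using QuotientAddGroup.norm_mk_le_norm (S := AddSubgroup.zmultiples (2 * π)) (m := x)

/-- If the energy dissipates infinitesimally close to `ψ`, it decays exponentially along the
solutions that start close to `ψ`. -/
lemma energy_decay {N : ℕ} {ω : ℝ} {g : Torus1 → ℝ} {A : Digraph (Fin N)} {ψ : Fin N → ℝ}
    {r : Fin N} {p : Fin N → ℝ} {c R ρ : ℝ} (hp : ∀ k, 0 < p k) (hc : 0 < c) (hρ : 0 ≤ ρ)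
    (hR : ∀ k, R ≤ p k * ρ ^ 2)
    (hlyap : ∀ u : Fin N → ℝ, u r = 0 → (∀ k, |u k| < ρ) →
      ∑ k, p k * (2 * u k * (∑ j, adjMatrix A j k * g ((ψ j - ψ k + (u j - u k) : ℝ) : Torus1) -
        ∑ j, adjMatrix A j r * g ((ψ j - ψ r + (u j - u r) : ℝ) : Torus1))) ≤
      -c * ∑ k, p k * u k ^ 2)
    {θ : ℝ → Phases N} (hθ : IsSolutionOn ω g A (Ici 0) θ) (h0 : energy ψ r p (θ 0) < R) {t : ℝ}
    (ht : 0 ≤ t) : energy ψ r p (θ t) ≤ energy ψ r p (θ 0) * exp (-c * t) := by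
  obtain ⟨φ, hφ⟩ := hθ
  choose y hy hyn using fun k => exists_coe_eq_abs_eq_norm (deviation ψ r (θ 0) k)
  have hyr : y r = 0 := by
    have := hyn r
    simpa [deviation] using this
  -- A continuous lift of the deviations, starting at their shortest representatives. Hence V equals
  -- the energy at time 0 and dominates it later, when the lift need no longer be shortest.
  set u : ℝ → Fin N → ℝ := fun t k => φ t k - φ t r - (φ 0 k - φ 0 r) + y k with hu
  have hcoe : ∀ t ∈ Ici (0 : ℝ), ∀ k, (u t k : Torus1) = deviation ψ r (θ t) k := by
    intro t ht k
    simp only [hu, AddCircle.coe_add, AddCircle.coe_sub, hy, deviation, (hφ t ht _).1,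
      (hφ 0 self_mem_Ici _).1]
    abel
  have hcoe' : ∀ t ∈ Ici (0 : ℝ), ∀ j k,
      ((ψ j - ψ k + (u t j - u t k) : ℝ) : Torus1) = θ t j - θ t k := by
    intro t ht j k
    rw [AddCircle.coe_add, AddCircle.coe_sub (2 * π) (u t j), hcoe t ht, hcoe t ht]
    simp only [deviation, AddCircle.coe_sub]
    abel
  have hur : ∀ t, u t r = 0 := fun t => by simp [hu, hyr]
  set V : ℝ → ℝ := fun t => ∑ k, p k * u t k ^ 2 with hV
  have hV0 : V 0 = energy ψ r p (θ 0) := by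
    simp only [hV, energy, ← hyn, sq_abs]
    simp [hu]
  have hVt : energy ψ r p (θ t) ≤ V t := by
    refine Finset.sum_le_sum fun k _ => mul_le_mul_of_nonneg_left ?_ (hp k).le
    rw [← hcoe t ht k, ← sq_abs (u t k)]
    exact pow_le_pow_left₀ (norm_nonneg _) (norm_coe_torus_le _) 2
  have hder : ∀ t ∈ Ici (0 : ℝ), HasDerivWithinAt V
      (∑ k, p k * (2 * u t k * (vectorField ω g A (θ t) k - vectorField ω g A (θ t) r)))
      (Ici 0) t := by
    intro t ht
    refine HasDerivWithinAt.fun_sum fun k _ => HasDerivWithinAt.const_mul _ ?_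
    have h1 : HasDerivWithinAt (fun s => u s k)
        (vectorField ω g A (θ t) k - vectorField ω g A (θ t) r) (Ici 0) t :=
      ((((hφ t ht k).2.sub (hφ t ht r).2).sub_const _).add_const _)
    simpa using h1.fun_pow 2
  rw [← hV0] at h0 ⊢
  refine hVt.trans (exp_decay_of_deriv_le hc hder (fun t => ?_) h0 (fun t ht hlt => ?_) ht)
  · exact Finset.sum_nonneg fun k _ => mul_nonneg (hp k).le (sq_nonneg _)
  · have hsmall : ∀ k, |u t k| < ρ := by
      intro k
      have h1 : p k * u t k ^ 2 ≤ V t := Finset.single_le_sum (f := fun k => p k * u t k ^ 2)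
        (fun k _ => mul_nonneg (hp k).le (sq_nonneg _)) (Finset.mem_univ k)
      have h2 : u t k ^ 2 < ρ ^ 2 :=
        lt_of_mul_lt_mul_left ((h1.trans_lt hlt).trans_le (hR k)) (hp k).le
      exact abs_lt_of_sq_lt_sq h2 hρ
    have := hlyap (u t) (hur t) hsmall
    simp only [hcoe' t ht] at this
    simpa only [vectorField, add_sub_add_left_eq_sub] using this

/-! ### From decay of the energy to asymptotic stability -/

lemma phaseShiftOrbit_nonempty {N : ℕ} (θ : Phases N) : (phaseShiftOrbit θ).Nonempty :=
  range_nonempty _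

lemma energy_nonneg {N : ℕ} {ψ : Fin N → ℝ} {r : Fin N} {p : Fin N → ℝ} (hp : ∀ k, 0 ≤ p k)
    (θ : Phases N) : 0 ≤ energy ψ r p θ :=
  Finset.sum_nonneg fun k _ => mul_nonneg (hp k) (sq_nonneg _)

lemma energy_eq_zero_of_mem_orbit {N : ℕ} {ψ : Fin N → ℝ} {r : Fin N} {p : Fin N → ℝ}
    {θ : Phases N} (hθ : θ ∈ phaseShiftOrbit fun k => (ψ k : Torus1)) : energy ψ r p θ = 0 := by
  obtain ⟨c, rfl⟩ := hθ
  simp [energy, deviation]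

lemma norm_deviation_le {N : ℕ} {ψ : Fin N → ℝ} {r : Fin N} {p : Fin N → ℝ} {m : ℝ} (hm : 0 < m)
    (hpm : ∀ k, m ≤ p k) (θ : Phases N) (k : Fin N) :
    ‖deviation ψ r θ k‖ ≤ √(energy ψ r p θ / m) := by
  apply le_sqrt_of_sq_le
  rw [le_div_iff₀ hm, mul_comm]
  refine (mul_le_mul_of_nonneg_right (hpm k) (sq_nonneg _)).trans ?_
  exact Finset.single_le_sum (f := fun k => p k * ‖deviation ψ r θ k‖ ^ 2)
    (fun k _ => mul_nonneg (hm.le.trans (hpm k)) (sq_nonneg _)) (Finset.mem_univ k)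

lemma infDist_orbit_le {N : ℕ} {ψ : Fin N → ℝ} {r : Fin N} {p : Fin N → ℝ} {m : ℝ} (hm : 0 < m)
    (hpm : ∀ k, m ≤ p k) (θ : Phases N) :
    Metric.infDist θ (phaseShiftOrbit fun k => (ψ k : Torus1)) ≤ √(energy ψ r p θ / m) := by
  have hmem : (fun k => θ r - (ψ r : Torus1) + (ψ k : Torus1)) ∈
      phaseShiftOrbit fun k => (ψ k : Torus1) := ⟨θ r - (ψ r : Torus1), rfl⟩
  refine (Metric.infDist_le_dist_of_mem hmem).trans ?_
  rw [dist_pi_le_iff (sqrt_nonneg _)]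
  intro k
  refine le_trans (le_of_eq ?_) (norm_deviation_le hm hpm θ k)
  rw [dist_eq_norm, deviation, AddCircle.coe_sub]
  congr 1
  abel

/-- A set containing the orbit of `ψ` that is suitably approximated by sublevel sets of the energy
is asymptotically stable if the energy decays. -/
lemma isAsymptoticallyStable_of_energy {N : ℕ} {ω : ℝ} {g : Torus1 → ℝ} {A : Digraph (Fin N)}
    {ψ : Fin N → ℝ} {r : Fin N} {p : Fin N → ℝ} {c R m E : ℝ} (hc : 0 < c) (hm : 0 < m)
    (hpm : ∀ k, m ≤ p k)
    (hdec : ∀ θ : ℝ → Phases N, IsSolutionOn ω g A (Ici 0) θ → energy ψ r p (θ 0) < R →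
      ∀ t, 0 ≤ t → energy ψ r p (θ t) ≤ energy ψ r p (θ 0) * exp (-c * t))
    {S : Set (Phases N)} (hS : phaseShiftOrbit (fun k => (ψ k : Torus1)) ⊆ S) (hER : E < R)
    (hSE : ∀ θ ∈ S, energy ψ r p θ ≤ E)
    (hnear : ∀ ε > 0, ∃ E' > E, ∀ θ, energy ψ r p θ < E' → Metric.infDist θ S < ε) :
    IsAsymptoticallyStable ω g A S := by
  have : Fact (0 < 2 * π) := ⟨two_pi_pos⟩
  have hp : ∀ k, 0 ≤ p k := fun k => hm.le.trans (hpm k)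
  have hSne : S.Nonempty := (phaseShiftOrbit_nonempty _).mono hS
  -- The energy is uniformly continuous on the compact torus, so states near S have energy barely
  -- above E.
  have hδ : ∀ E' > E, ∃ δ > 0, ∀ θ, Metric.infDist θ S < δ → energy ψ r p θ < E' := by
    intro E' hE'
    obtain ⟨δ, hδ, h⟩ := Metric.uniformContinuous_iff.1
      (CompactSpace.uniformContinuous_of_continuous (continuous_energy ψ r p)) (E' - E)
      (sub_pos.2 hE')
    refine ⟨δ, hδ, fun θ hθ => ?_⟩
    obtain ⟨b, hb, hd⟩ := (Metric.infDist_lt_iff hSne).1 hθ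
    have h1 := h hd
    rw [Real.dist_eq] at h1
    linarith [le_abs_self (energy ψ r p θ - energy ψ r p b), hSE b hb]
  refine ⟨fun ε hε => ?_, ?_⟩
  · obtain ⟨E', hE', h⟩ := hnear ε hε
    obtain ⟨δ, hδ, h'⟩ := hδ (min E' R) (lt_min hE' hER)
    refine ⟨δ, hδ, fun θ hθ h0 t ht => h _ ?_⟩
    have h1 := h' _ h0
    refine lt_of_le_of_lt (hdec θ hθ (h1.trans_le (min_le_right _ _)) t ht)
      (lt_of_le_of_lt ?_ (h1.trans_le (min_le_left _ _)))
    refine mul_le_of_le_one_right (energy_nonneg hp _) ?_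
    rw [exp_le_one_iff]
    nlinarith
  · obtain ⟨δ, hδ, h'⟩ := hδ R hER
    refine ⟨δ, hδ, fun θ hθ h0 => ?_⟩
    have hlim : Tendsto (fun t => √(energy ψ r p (θ 0) * exp (-c * t) / m)) atTop (𝓝 0) := by
      have h1 : Tendsto (fun t => exp (-c * t)) atTop (𝓝 0) :=
        tendsto_exp_atBot.comp (tendsto_id.const_mul_atTop_of_neg (neg_lt_zero.2 hc))
      have h2 := ((h1.const_mul (energy ψ r p (θ 0))).div_const m).sqrt
      simpa using h2
    refine tendsto_of_tendsto_of_tendsto_of_le_of_le' tendsto_const_nhds hlim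
      (Eventually.of_forall fun t => Metric.infDist_nonneg) ?_
    filter_upwards [eventually_ge_atTop 0] with t ht
    -- S contains the orbit, so it suffices that the distance to the orbit tends to 0.
    refine (Metric.infDist_le_infDist_of_subset hS (phaseShiftOrbit_nonempty _)).trans
      ((infDist_orbit_le (r := r) hm hpm _).trans (sqrt_le_sqrt ?_))
    exact div_le_div_of_nonneg_right (hdec θ hθ (h' _ h0) t ht) hm.le

lemma isAsymptoticallyStable_orbit {N : ℕ} {ω : ℝ} {g : Torus1 → ℝ} {A : Digraph (Fin N)}
    {ψ : Fin N → ℝ} {r : Fin N} {p : Fin N → ℝ} {c R m : ℝ} (hc : 0 < c) (hm : 0 < m)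
    (hpm : ∀ k, m ≤ p k) (hR : 0 < R)
    (hdec : ∀ θ : ℝ → Phases N, IsSolutionOn ω g A (Ici 0) θ → energy ψ r p (θ 0) < R →
      ∀ t, 0 ≤ t → energy ψ r p (θ t) ≤ energy ψ r p (θ 0) * exp (-c * t)) :
    IsAsymptoticallyStable ω g A (phaseShiftOrbit fun k => (ψ k : Torus1)) := by
  refine isAsymptoticallyStable_of_energy hc hm hpm hdec Subset.rfl hR
    (fun θ hθ => (energy_eq_zero_of_mem_orbit hθ).le) fun ε hε => ?_
  refine ⟨m * ε ^ 2, by positivity, fun θ hθ => (infDist_orbit_le (r := r) hm hpm θ).trans_lt ?_⟩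
  rw [sqrt_lt' hε, div_lt_iff₀ hm, mul_comm]
  exact hθ

/-- Shrinking the deviations of `θ` by a factor `l` yields a nearby state of smaller energy. -/
lemma exists_shrink {N : ℕ} {ψ : Fin N → ℝ} {r : Fin N} {p : Fin N → ℝ} (hp : ∀ k, 0 ≤ p k)
    (θ : Phases N) {l : ℝ} (h0 : 0 ≤ l) (h1 : l ≤ 1) :
    ∃ b : Phases N, energy ψ r p b ≤ l ^ 2 * energy ψ r p θ ∧ dist θ b ≤ (1 - l) * π := by
  choose y hy hyn using fun k => exists_coe_eq_abs_eq_norm (deviation ψ r θ k)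
  have hyr : y r = 0 := by
    have := hyn r
    simpa [deviation] using this
  refine ⟨fun k => θ r + ((ψ k - ψ r : ℝ) : Torus1) + ((l * y k : ℝ) : Torus1), ?_, ?_⟩
  · rw [energy, energy, Finset.mul_sum]
    refine Finset.sum_le_sum fun k _ => ?_
    have e : deviation ψ r (fun k => θ r + ((ψ k - ψ r : ℝ) : Torus1) + ((l * y k : ℝ) : Torus1)) k
        = ((l * y k : ℝ) : Torus1) := by
      simp only [deviation, hyr, sub_self, mul_zero, AddCircle.coe_zero]
      abel
    have h2 : ‖((l * y k : ℝ) : Torus1)‖ ≤ l * ‖deviation ψ r θ k‖ := by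
      refine (norm_coe_torus_le _).trans (le_of_eq ?_)
      rw [abs_mul, abs_of_nonneg h0, hyn]
    rw [e]
    calc p k * ‖((l * y k : ℝ) : Torus1)‖ ^ 2 ≤ p k * (l * ‖deviation ψ r θ k‖) ^ 2 :=
          mul_le_mul_of_nonneg_left (pow_le_pow_left₀ (norm_nonneg _) h2 2) (hp k)
      _ = l ^ 2 * (p k * ‖deviation ψ r θ k‖ ^ 2) := by ring
  · rw [dist_pi_le_iff (mul_nonneg (by linarith) pi_pos.le)]
    intro k
    have e : θ k - (θ r + ((ψ k - ψ r : ℝ) : Torus1) + ((l * y k : ℝ) : Torus1)) =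
        (((1 - l) * y k : ℝ) : Torus1) := by
      rw [sub_mul, one_mul, AddCircle.coe_sub (2 * π) (y k), hy, deviation]
      abel
    rw [dist_eq_norm, e]
    refine (norm_coe_torus_le _).trans ?_
    rw [abs_mul, abs_of_nonneg (by linarith : 0 ≤ 1 - l), hyn]
    refine mul_le_mul_of_nonneg_left ?_ (by linarith)
    have := AddCircle.norm_le_half_period (2 * π) two_pi_pos.ne' (x := deviation ψ r θ k)
    rw [abs_of_pos two_pi_pos] at this
    linarith

/-- The point is that energy slightly above E forces proximity to the sublevel set. Scaling the
deviations by 1 - τ brings energy below E/(1 - τ)² under E and moves the state by at most τπ < ε. -/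
lemma isAsymptoticallyStable_sublevel {N : ℕ} {ω : ℝ} {g : Torus1 → ℝ} {A : Digraph (Fin N)}
    {ψ : Fin N → ℝ} {r : Fin N} {p : Fin N → ℝ} {c R m E : ℝ} (hc : 0 < c) (hm : 0 < m)
    (hpm : ∀ k, m ≤ p k) (hE : 0 < E) (hER : E < R)
    (hdec : ∀ θ : ℝ → Phases N, IsSolutionOn ω g A (Ici 0) θ → energy ψ r p (θ 0) < R →
      ∀ t, 0 ≤ t → energy ψ r p (θ t) ≤ energy ψ r p (θ 0) * exp (-c * t)) :
    IsAsymptoticallyStable ω g A {θ | energy ψ r p θ < E} := by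
  refine isAsymptoticallyStable_of_energy hc hm hpm hdec
    (fun θ hθ => (energy_eq_zero_of_mem_orbit hθ).trans_lt hE) hER (fun θ hθ => le_of_lt hθ)
    fun ε hε => ?_
  have hπ := pi_pos
  set τ := min (1 / 2) (ε / (2 * π)) with hτ
  have hτ0 : 0 < τ := lt_min (by norm_num) (by positivity)
  have hτ1 : τ ≤ 1 / 2 := min_le_left _ _
  have hτ2 : τ * π < ε := by
    have : τ ≤ ε / (2 * π) := min_le_right _ _
    rw [le_div_iff₀ (by positivity)] at this
    nlinarith
  have hl : 0 < (1 - τ) ^ 2 := by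
    have : 0 < 1 - τ := by linarith
    positivity
  refine ⟨E / (1 - τ) ^ 2, ?_, fun θ hθ => ?_⟩
  · rw [gt_iff_lt, lt_div_iff₀ hl]
    exact mul_lt_of_lt_one_right hE (by nlinarith)
  · obtain ⟨b, hb, hd⟩ := exists_shrink (ψ := ψ) (r := r) (fun k => hm.le.trans (hpm k)) θ
      (l := 1 - τ) (by linarith) (by linarith)
    have hbE : energy ψ r p b < E := by
      rw [lt_div_iff₀ hl] at hθ
      linarith
    refine (Metric.infDist_le_dist_of_mem (show b ∈ {θ | energy ψ r p θ < E} from hbE)).trans_lt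
      (hd.trans_lt ?_)
    rwa [sub_sub_cancel]

lemma isForwardInvariant_sublevel {N : ℕ} {ω : ℝ} {g : Torus1 → ℝ} {A : Digraph (Fin N)}
    {ψ : Fin N → ℝ} {r : Fin N} {p : Fin N → ℝ} {c R E : ℝ} (hc : 0 < c)
    (hp : ∀ k, 0 ≤ p k) (hER : E < R)
    (hdec : ∀ θ : ℝ → Phases N, IsSolutionOn ω g A (Ici 0) θ → energy ψ r p (θ 0) < R →
      ∀ t, 0 ≤ t → energy ψ r p (θ t) ≤ energy ψ r p (θ 0) * exp (-c * t)) :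
    IsForwardInvariant ω g A {θ | energy ψ r p θ < E} := by
  intro θ hθ h0 t ht
  have h1 : energy ψ r p (θ 0) < E := h0
  refine lt_of_le_of_lt ((hdec θ hθ (h1.trans hER) t ht).trans ?_) h1
  refine mul_le_of_le_one_right (energy_nonneg hp _) ?_
  rw [exp_le_one_iff]
  nlinarith

/-! ### Realising a graph -/

open Classical in
/-- The differences of the phases `sidonPhase` along the edges of `H`, together with `0`. -/
noncomputable def edgeCentres {N : ℕ} (H : Digraph (Fin N)) : Finset ℝ :=
  -- The centre 0 keeps the coupling non-constant even if H has no edges. Without self-loops it is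
  -- not the difference of any edge.
  insert 0 ((Finset.univ.filter fun e : Fin N × Fin N => H.Adj e.1 e.2).image
    fun e => sidonPhase N e.1 - sidonPhase N e.2)

open Classical in
/-- The weight `1` at the differences of the phases along the edges of `T`, and `η` elsewhere. -/
noncomputable def edgeWeight {N : ℕ} (T : Digraph (Fin N)) (η c : ℝ) : ℝ :=
  if ∃ j k, T.Adj j k ∧ sidonPhase N j - sidonPhase N k = c then 1 else η

lemma exists_sub_eq_of_mem_edgeCentres {N : ℕ} (hN : N ≠ 0) {H : Digraph (Fin N)} {c : ℝ}
    (hc : c ∈ edgeCentres H) : ∃ j k, sidonPhase N j - sidonPhase N k = c := by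
  rcases Finset.mem_insert.1 hc with rfl | h
  · exact ⟨⟨0, Nat.pos_of_ne_zero hN⟩, ⟨0, Nat.pos_of_ne_zero hN⟩, sub_self _⟩
  · obtain ⟨e, _, he⟩ := Finset.mem_image.1 h
    exact ⟨e.1, e.2, he⟩

lemma isSeparated_edgeCentres {N : ℕ} (hN : N ≠ 0) (H : Digraph (Fin N)) :
    IsSeparated (sidonGap N) (edgeCentres H) where
  pos := sidonGap_pos N
  le := sidonGap_le hN
  abs_le c hc := by
    obtain ⟨j, k, rfl⟩ := exists_sub_eq_of_mem_edgeCentres hN hc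
    exact abs_sidonPhase_sub_le j k
  sep c hc c' hc' hne := by
    obtain ⟨j, k, rfl⟩ := exists_sub_eq_of_mem_edgeCentres hN hc
    obtain ⟨j', k', rfl⟩ := exists_sub_eq_of_mem_edgeCentres hN hc'
    exact two_sidonGap_le_of_ne hne

lemma mem_edgeCentres_iff {N : ℕ} (H : Digraph (Fin N)) {j k : Fin N} (hjk : j ≠ k) :
    sidonPhase N j - sidonPhase N k ∈ edgeCentres H ↔ H.Adj j k := by
  simp only [edgeCentres, Finset.mem_insert, Finset.mem_image, Finset.mem_filter,
    Finset.mem_univ, true_and, Prod.exists]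
  constructor
  · rintro (h | ⟨j', k', h, e⟩)
    · obtain ⟨h1, h2⟩ := sidonPhase_sub_injective hjk (h.trans (sub_self (sidonPhase N j)).symm)
      exact absurd h2.symm hjk
    · obtain ⟨rfl, rfl⟩ := sidonPhase_sub_injective hjk e.symm
      exact h
  · exact fun h => Or.inr ⟨j, k, h, rfl⟩

open Classical in
lemma edgeWeight_sub {N : ℕ} (T : Digraph (Fin N)) (η : ℝ) {j k : Fin N} (hjk : j ≠ k) :
    edgeWeight T η (sidonPhase N j - sidonPhase N k) = if T.Adj j k then 1 else η := by
  unfold edgeWeight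
  congr 1
  refine propext ⟨?_, fun h => ⟨j, k, h, rfl⟩⟩
  rintro ⟨j', k', h, e⟩
  obtain ⟨rfl, rfl⟩ := sidonPhase_sub_injective hjk e.symm
  exact h

lemma cos_lt_of_notMem_edgeCentres {N : ℕ} {H : Digraph (Fin N)} {j k : Fin N}
    (h : sidonPhase N j - sidonPhase N k ∉ edgeCentres H) {s : ℝ} (hs : |s| < sidonGap N) :
    ∀ c ∈ edgeCentres H, cos (sidonPhase N j - sidonPhase N k + s - c) < cos (sidonGap N) := by
  intro c hc
  have hN : N ≠ 0 := fun e => (e ▸ j).elim0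
  obtain ⟨j', k', rfl⟩ := exists_sub_eq_of_mem_edgeCentres hN hc
  exact cos_lt_of_separated (sidonGap_pos N) (sidonGap_le hN) (abs_sidonPhase_sub_le j k)
    (abs_sidonPhase_sub_le j' k') (two_sidonGap_le_of_ne fun e => h (e ▸ hc)) hs

/-- The coupling function that realises the graph `H` with spanning tree `T`. -/
noncomputable def treeCoupling {N : ℕ} (H T : Digraph (Fin N)) (η : ℝ) : Torus1 → ℝ :=
  pulseCoupling (sidonGap N) (edgeCentres H) (edgeWeight T η)

open Classical in
/-- The strength of the edge from `j` to `k`. -/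
noncomputable def edgeStrength {N : ℕ} (H T : Digraph (Fin N)) (η : ℝ) (j k : Fin N) : ℝ :=
  if H.Adj j k then (if T.Adj j k then 1 else η) else 0

/-- Near the chosen phases each edge of H sees only its own pulse, edges of A outside H see a dead
zone, and pairs not joined in A are cut off by the adjacency matrix. -/
lemma adjMatrix_mul_treeCoupling {N : ℕ} {A H : Digraph (Fin N)} (T : Digraph (Fin N)) (η : ℝ)
    (hA : ∀ k, ¬ A.Adj k k) (hHA : H ≤ A) (j k : Fin N) {s : ℝ} (hs : |s| < sidonGap N) :
    adjMatrix A j k * treeCoupling H T η ((sidonPhase N j - sidonPhase N k + s : ℝ) : Torus1) =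
      edgeStrength H T η j k * pulse (sidonGap N) s := by
  classical
  have hN : N ≠ 0 := fun e => (e ▸ j).elim0
  rw [treeCoupling, pulseCoupling_coe, adjMatrix, Matrix.of_apply, edgeStrength]
  by_cases hAjk : A.Adj j k
  · have hjk : j ≠ k := fun e => hA k (e ▸ hAjk)
    rw [if_pos hAjk, one_mul]
    by_cases hH : H.Adj j k
    · rw [if_pos hH, pulseSum_of_mem (isSeparated_edgeCentres hN H) _
        ((mem_edgeCentres_iff H hjk).2 hH) hs, edgeWeight_sub T η hjk]
    · rw [if_neg hH, zero_mul]
      exact pulseSum_eq_zero_of_forall_cos_le _ fun c hc =>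
        (cos_lt_of_notMem_edgeCentres (fun h => hH ((mem_edgeCentres_iff H hjk).1 h)) hs c hc).le
  · rw [if_neg hAjk, if_neg fun h => hAjk (hHA h), zero_mul, zero_mul]

lemma edgeWeight_ne_zero {N : ℕ} (T : Digraph (Fin N)) {η : ℝ} (hη : 0 < η) (c : ℝ) :
    edgeWeight T η c ≠ 0 := by
  unfold edgeWeight
  split_ifs
  · exact one_ne_zero
  · exact hη.ne'

lemma isCouplingFunction_treeCoupling {N : ℕ} (hN : N ≠ 0) (H T : Digraph (Fin N)) {η : ℝ}
    (hη : 0 < η) : IsCouplingFunction (treeCoupling H T η) :=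
  isCouplingFunction_pulseCoupling (isSeparated_edgeCentres hN H) ⟨0, Finset.mem_insert_self _ _⟩
    fun c _ => edgeWeight_ne_zero T hη c

lemma effectiveGraph_treeCoupling {N : ℕ} {A H : Digraph (Fin N)} (T : Digraph (Fin N)) {η : ℝ}
    (hη : 0 < η) (hA : ∀ k, ¬ A.Adj k k) (hHA : H ≤ A) {r : Fin N} {θ : Phases N}
    (hθ : ∀ k, ‖deviation (sidonPhase N) r θ k‖ < sidonGap N / 2) :
    effectiveGraph (treeCoupling H T η) A θ = H := by
  have hN : N ≠ 0 := fun e => (e ▸ r).elim0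
  choose y hy hyn using fun k => exists_coe_eq_abs_eq_norm (deviation (sidonPhase N) r θ k)
  ext j k
  have e : θ j - θ k = ((sidonPhase N j - sidonPhase N k + (y j - y k) : ℝ) : Torus1) := by
    rw [AddCircle.coe_add, AddCircle.coe_sub (2 * π) (y j), hy, hy]
    simp only [deviation, AddCircle.coe_sub]
    abel
  have hs : |y j - y k| < sidonGap N := by
    have h1 := hθ j
    have h2 := hθ k
    rw [← hyn] at h1 h2
    linarith [abs_sub (y j) (y k)]
  change A.Adj j k ∧ θ j - θ k ∉ DZ (treeCoupling H T η) ↔ H.Adj j k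
  rw [e, treeCoupling, mem_DZ_pulseCoupling_iff (isSeparated_edgeCentres hN H)
    fun c _ => edgeWeight_ne_zero T hη c]
  constructor
  · rintro ⟨hAjk, h⟩
    by_contra hH
    have hjk : j ≠ k := fun e => hA k (e ▸ hAjk)
    exact h (cos_lt_of_notMem_edgeCentres (fun h => hH ((mem_edgeCentres_iff H hjk).1 h)) hs)
  · intro hH
    have hjk : j ≠ k := by
      rintro rfl
      exact hA j (hHA hH)
    refine ⟨hHA hH, fun h => ?_⟩
    have h1 := h _ ((mem_edgeCentres_iff H hjk).2 hH)
    rw [add_sub_cancel_left] at h1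
    have h2 := cos_lt_cos_of_abs_lt
      (by linarith [sidonGap_le hN, pi_pos] : sidonGap N ≤ π) hs
    linarith

lemma isRelativeEquilibrium_treeCoupling {N : ℕ} (ω : ℝ) {A H : Digraph (Fin N)}
    (T : Digraph (Fin N)) (η : ℝ) (hA : ∀ k, ¬ A.Adj k k) (hHA : H ≤ A) :
    IsRelativeEquilibrium ω (treeCoupling H T η) A ω (fun k => (sidonPhase N k : Torus1)) := by
  refine ⟨fun t k => ω * t + sidonPhase N k, fun t _ k => ⟨AddCircle.coe_add .., ?_⟩⟩
  have h : vectorField ω (treeCoupling H T η) A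
      (fun k => ((ω * t : ℝ) : Torus1) + (sidonPhase N k : Torus1)) k = ω := by
    rw [vectorField, Finset.sum_eq_zero, add_zero]
    intro j _
    have h0 := adjMatrix_mul_treeCoupling T η hA hHA j k (s := 0)
      (by simpa using sidonGap_pos N)
    rw [pulse_zero, mul_zero, add_zero, AddCircle.coe_sub] at h0
    rwa [add_sub_add_left_eq_sub]
  rw [h]
  simpa using ((hasDerivAt_id t).const_mul ω).add_const (sidonPhase N k)

lemma realises_of_spanningDivergingTree (N : ℕ) (ω : ℝ) (A H : Digraph (Fin N))
    (hA : ∀ k, ¬ A.Adj k k) (hHA : H ≤ A) (hH : HasSpanningDivergingTree H) :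
    ∃ g : Torus1 → ℝ, IsCouplingFunction g ∧
      (∃ (Ω : ℝ) (θ₀ : Phases N), IsRelativeEquilibrium ω g A Ω θ₀ ∧
        IsAsymptoticallyStable ω g A (phaseShiftOrbit θ₀) ∧ effectiveGraph g A θ₀ = H) ∧
      StablyRealises ω g A H := by
  classical
  obtain ⟨T, hTH, hT⟩ := hH
  obtain ⟨r, par, depth, hr, hpar, hdepth⟩ := hT.exists_depth
  have hN : N ≠ 0 := fun e => (e ▸ r).elim0
  have hN1 : (1 : ℝ) ≤ N := by exact_mod_cast Nat.one_le_iff_ne_zero.2 hN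
  have hε := sidonGap_pos N
  obtain ⟨a₀, ha₀, ha₁, hslope⟩ := exists_pulse_slope hε (sidonGap_le hN)
  -- Chosen so that N μ = a₀/2. The slope a₀ belongs to the unweighted pulse, so μ and the weights p
  -- do not depend on η.
  set μ : ℝ := a₀ / (2 * N) with hμ
  have hμ0 : 0 < μ := by positivity
  have hμ1 : μ ≤ 1 := by
    rw [hμ, div_le_one (by positivity)]
    linarith
  set p : Fin N → ℝ := fun k => μ ^ depth k with hp
  have hp0 : ∀ k, 0 < p k := fun k => pow_pos hμ0 _
  have hp1 : ∀ k, p k ≤ 1 := fun k => pow_le_one₀ hμ0.le hμ1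
  obtain ⟨m, hm, hpm⟩ : ∃ m : ℝ, 0 < m ∧ ∀ k, m ≤ p k := by
    obtain ⟨k, -, hk⟩ := Finset.exists_min_image Finset.univ p ⟨r, Finset.mem_univ r⟩
    exact ⟨p k, hp0 k, fun j => hk j (Finset.mem_univ j)⟩
  -- Chosen so that 6 N η = a₀ m/4.
  set η : ℝ := a₀ * m / (24 * N) with hη
  have hη0 : 0 < η := by positivity
  -- Deviations below ρ differ by less than half the gap, where the slope bounds hold; energy below
  -- m ρ² forces such deviations.
  set ρ : ℝ := sidonGap N / 4 with hρ
  set R : ℝ := m * ρ ^ 2 with hR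
  have hR0 : 0 < R := by positivity
  set g := treeCoupling H T η with hg
  have hdec : ∀ θ : ℝ → Phases N, IsSolutionOn ω g A (Ici 0) θ →
      energy (sidonPhase N) r p (θ 0) < R → ∀ t, 0 ≤ t →
      energy (sidonPhase N) r p (θ t) ≤ energy (sidonPhase N) r p (θ 0) * exp (-(a₀ / 4) * t) := by
    intro θ hθ h0 t ht
    refine energy_decay (ρ := ρ) hp0 (by positivity) (by positivity)
      (fun k => mul_le_mul_of_nonneg_right (hpm k) (sq_nonneg _)) ?_ hθ h0 ht
    intro u hur hu
    have hd : ∀ j k, |u j - u k| < sidonGap N := fun j k => by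
      linarith [abs_sub (u j) (u k), hu j, hu k]
    simp only [hg, adjMatrix_mul_treeCoupling T η hA hHA _ _ (hd _ _)]
    refine sum_weighted_network_le (R := sidonGap N / 2) (η := η) (μ := μ) (par := par) hm hpm hp1
      hμ0.le ha₀.le hη0.le (fun k hk => ?_) ?_ ?_ (fun k hk => ?_) (fun j k h => ?_) hslope
      (fun k => ?_) hur
    · simp only [hp, hdepth k hk, pow_succ]
      exact (mul_comm _ _).le
    · rw [Fintype.card_fin, hμ]
      field_simp
      exact le_rfl
    · rw [Fintype.card_fin, hη]
      field_simp
      norm_num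
    · have := (hpar k hk (par k)).2 rfl
      rw [edgeStrength, if_pos (hTH this), if_pos this]
    · have hnT : ¬ T.Adj j k := by
        by_cases hk : k = r
        · exact hk ▸ hr j
        · exact fun h' => h.resolve_left hk ((hpar k hk j).1 h')
      rw [edgeStrength, if_neg hnT]
      split_ifs
      · exact ⟨hη0.le, le_rfl⟩
      · exact ⟨le_rfl, hη0.le⟩
    · linarith [hu k]
  have heff : ∀ θ, energy (sidonPhase N) r p θ < R → effectiveGraph g A θ = H := by
    intro θ hθ
    refine effectiveGraph_treeCoupling T hη0 hA hHA (r := r) fun k => ?_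
    refine (norm_deviation_le hm hpm θ k).trans_lt ?_
    have : √(energy (sidonPhase N) r p θ / m) < ρ := by
      rw [sqrt_lt' (by positivity), div_lt_iff₀ hm, mul_comm]
      exact hθ
    linarith
  have hzero : energy (sidonPhase N) r p (fun k => (sidonPhase N k : Torus1)) = 0 :=
    energy_eq_zero_of_mem_orbit ⟨0, by simp⟩
  have hc : 0 < a₀ / 4 := by positivity
  refine ⟨g, isCouplingFunction_treeCoupling hN H T hη0,
    ⟨ω, _, isRelativeEquilibrium_treeCoupling ω T η hA hHA,
      isAsymptoticallyStable_orbit hc hm hpm hR0 hdec, heff _ (hzero ▸ hR0)⟩,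
    {θ | energy (sidonPhase N) r p θ < R / 2}, ⟨_, hzero.trans_lt (half_pos hR0)⟩,
    isOpen_lt (continuous_energy _ _ _) continuous_const,
    fun θ hθ => heff θ (lt_trans hθ (half_lt_self hR0)),
    isForwardInvariant_sublevel hc (fun k => (hp0 k).le) (half_lt_self hR0) hdec,
    isAsymptoticallyStable_sublevel hc hm hpm (half_pos hR0) (half_lt_self hR0) hdec⟩

end DeadZones

theorem mainTheorem2 (N : ℕ) (ω : ℝ) (A H : Digraph (Fin N)) (hA : ∀ k, ¬ A.Adj k k)
    (hHA : H ≤ A) (hH : DeadZones.HasSpanningDivergingTree H) :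
    ∃ g : DeadZones.Torus1 → ℝ, DeadZones.IsCouplingFunction g ∧
      (∃ (Ω : ℝ) (θ₀ : DeadZones.Phases N),
        DeadZones.IsRelativeEquilibrium ω g A Ω θ₀ ∧
        DeadZones.IsAsymptoticallyStable ω g A (DeadZones.phaseShiftOrbit θ₀) ∧
        DeadZones.effectiveGraph g A θ₀ = H) ∧
      DeadZones.StablyRealises ω g A H :=
  DeadZones.realises_of_spanningDivergingTree N ω A H hA hHA hH
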